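/- Let $\mathcal M$ be a von Neumann algebra acting on a complex Hilbert space $\mathcal H$, and let $A\in\mathcal M$ be a nonzero positive element. Let $\mathcal M^A$ be the set of all $T\in\mathcal M$ for which there is $S\in\mathcal M$ with $A^{1/2}S=T^*A^{1/2}$. An element $T\in\mathcal M^A$ is called $A$-invertible if there is $S\in\mathcal M^A$ with $ATS=AST=A$, and the $A$-spectrum of $T\in\mathcal M^A$ is $$\sigma_A(T)=\{\lambda\in\mathbb C:\ \lambda I-T \text{ is not } A\text{-invertible}\}.$$ $A$ is called well-supported if $\sigma(A)\setminus\{0\}$ is closed. A bounded linear functional $f$ on $\mathcal M$ is positive if $f(X)\ge 0$ for all positive $X\in\mathcal M$. A positive linear functional $\tau$ on $\mathcal M$ with $\tau(A)=1$ is called $A$-pure if every positive linear functional $p$ on $\mathcal M$ with $p(X)\le\tau(X)$ for all positive $X\in\mathcal M$ is of the form $p=\alpha\tau$ with $\alpha\in[0,1]$ (for $A=I$ these are the pure states of $\mathcal M$). For $T\in\mathcal M^A$ let $\mathcal P_A(T)$ be the set of all $A$-pure $\tau$ such that $$\tau(ATS)=\tau(AT)\,\tau(AS)\ \text{ for all }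 S\in A^{1/2}\mathcal M A^{1/2},$$ or $$\tau(AST)=\tau(AT)\,\tau(AS)\ \text{ for all } S\in A^{1/2}\mathcal M A^{1/2}.$$ **Theorem.** If $A$ is well-supported, then for every $T\in\mathcal M^A$, $$\sigma_A(T)=\{g(AT):\ g\in\mathcal P_A(T)\}.$$ In particular, for $A=I$: for every $T\in\mathcal M$ the spectrum of $T$ in $\mathcal M$ is $$\sigma(T)=\{g(T):\ g\in\mathcal P_I(T)\}.$$ -/

import Mathlib

open scoped ComplexOrder

namespace ASpectrum

variable {H : Type*} [NormedAddCommGroup H] [InnerProductSpace ℂ H] [CompleteSpace H]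

/-- The elements of a von Neumann algebra `M` acting on `H`, as a unital star algebra with the
operator norm. -/
abbrev Elt (M : VonNeumannAlgebra H) : Type _ := M.toStarSubalgebra

/-- The square root `A^{1/2}` of a positive element, as an operator on `H`. -/
noncomputable def sqrtOp {M : VonNeumannAlgebra H} (A : Elt M) : H →L[ℂ] H :=
  CFC.sqrt (A : H →L[ℂ] H)

/-- `A` is a positive element of `M` (that is, a positive operator lying in `M`). -/
def IsPos {M : VonNeumannAlgebra H} (A : Elt M) : Prop :=
  0 ≤ (A : H →L[ℂ] H)

/-- `A` is well-supported: `σ(A) \ {0}` is closed. -/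
def WellSupported {M : VonNeumannAlgebra H} (A : Elt M) : Prop :=
  IsClosed (spectrum ℂ A \ {0})

/-- `M^A`: the elements `T` of `M` admitting an `A^{1/2}`-adjoint in `M`, i.e. some `S ∈ M` with
`A^{1/2} S = T* A^{1/2}`. -/
def aBounded {M : VonNeumannAlgebra H} (A : Elt M) : Set (Elt M) :=
  {T | ∃ S : Elt M, sqrtOp A * (S : H →L[ℂ] H) = star (T : H →L[ℂ] H) * sqrtOp A}

/-- `T` is `A`-invertible in `M^A`: it has an `A`-inverse belonging to `M^A`. -/
def IsAInvertible {M : VonNeumannAlgebra H} (A T : Elt M) : Prop :=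
  ∃ S ∈ aBounded A, A * T * S = A ∧ A * S * T = A

/-- The `A`-spectrum of `T`. -/
def aSpectrum {M : VonNeumannAlgebra H} (A T : Elt M) : Set ℂ :=
  {z | ¬ IsAInvertible A (algebraMap ℂ (Elt M) z - T)}

/-- A positive linear functional on `M`. -/
def IsPosFunctional {M : VonNeumannAlgebra H} (f : Elt M →L[ℂ] ℂ) : Prop :=
  ∀ X : Elt M, IsPos X → 0 ≤ f X

/-- `τ` is `A`-pure: a positive functional with `τ(A) = 1`, such that each positive functional
dominated by `τ` on the positive cone is `α τ` for a scalar `α ∈ [0, 1]`. For `A = 1` these are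
the pure states of `M`. -/
def IsAPure {M : VonNeumannAlgebra H} (A : Elt M) (τ : Elt M →L[ℂ] ℂ) : Prop :=
  IsPosFunctional τ ∧ τ A = 1 ∧
    ∀ p : Elt M →L[ℂ] ℂ, IsPosFunctional p → (∀ X : Elt M, IsPos X → p X ≤ τ X) →
      ∃ α : ℝ, 0 ≤ α ∧ α ≤ 1 ∧ p = (α : ℂ) • τ

/-- The set `A^{1/2} M A^{1/2}`. -/
def halfCorner {M : VonNeumannAlgebra H} (A : Elt M) : Set (Elt M) :=
  {S | ∃ X : Elt M, (S : H →L[ℂ] H) = sqrtOp A * (X : H →L[ℂ] H) * sqrtOp A}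

/-- `P_A^r(T)`. -/
def pureRight {M : VonNeumannAlgebra H} (A T : Elt M) : Set (Elt M →L[ℂ] ℂ) :=
  {τ | IsAPure A τ ∧ ∀ S ∈ halfCorner A, τ (A * T * S) = τ (A * T) * τ (A * S)}

/-- `P_A^l(T)`. -/
def pureLeft {M : VonNeumannAlgebra H} (A T : Elt M) : Set (Elt M →L[ℂ] ℂ) :=
  {τ | IsAPure A τ ∧ ∀ S ∈ halfCorner A, τ (A * S * T) = τ (A * T) * τ (A * S)}

/-- `P_A(T)`, the union of `P_A^l(T)` and `P_A^r(T)`. -/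
def pureMult {M : VonNeumannAlgebra H} (A T : Elt M) : Set (Elt M →L[ℂ] ℂ) :=
  pureLeft A T ∪ pureRight A T

end ASpectrum

/-!
Since `σ(A) \ {0}` is closed, the continuous functional calculus gives the positive root
`Q = A^{1/2}` a pseudo-inverse `R` inside `M` (`exists_sqrt_pseudoinverse`), and `P = Q R` is the
support projection of `A`. Everything then takes place in the corner `P M P`: `A` is invertible
there, `A^{1/2} M A^{1/2} = P M P`, an element `T` of `M^A` satisfies `P T = P T P`, and `T` is
`A`-invertible exactly when `P T P` is invertible in the corner. To stay in a unital algebra with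
the same unit, the corner element `P D P`, where `D = z - T`, is replaced by `P D P + (1 - P)`.

If `g ∈ P_A(T)` and `z = g(AT)`, then one of `S ↦ g(A D S)`, `S ↦ g(A S D)` vanishes on the corner.
An `A`-inverse of `D`, compressed to the corner, would make this value `g(A) = 1`; so `z` belongs to
the `A`-spectrum.

Conversely let `Y = P D P + (1 - P)` be non-invertible. Either `Y` is not left invertible, or
`(A + (1 - P)) Y` is not right invertible. A proper left ideal generated by a single element `Z` is
killed by a pure state (`exists_pure_apply_mul_eq_zero`): the states vanishing on `Z⋆ Z` form a
nonempty weak-⋆ compact face of the state space, and Krein–Milman provides an extreme point. Applied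
to `Z = Y`, or to `Z = Y⋆ (A + (1 - P))` followed by taking adjoints, and rescaled at `A`
(`IsPseudoSqrt.exists_pure`), this yields an `A`-pure functional that is multiplicative against `T`
on one side and has value `z` at `A T`. The factor `A + (1 - P)` in the second case is needed since the
functional must kill `A D S` rather than `D S`.
-/

open scoped ComplexOrder

namespace ASpectrum

/-! ### Positive functionals on a C⋆-algebra -/

section StarAlgebra

variable {𝔐 : Type*} [CStarAlgebra 𝔐] [PartialOrder 𝔐] [StarOrderedRing 𝔐]

/-- A contractive unital functional on a C⋆-algebra is real on self-adjoint elements: for `X`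
self-adjoint and `t` real, `|f (X + i t)|² ≤ ‖X‖² + t²`, and `t` can be
chosen to contradict this if `f X` has a nonzero imaginary part. -/
theorem im_apply_eq_zero_of_norm_le_one {𝔐 : Type*} [CStarAlgebra 𝔐]
    {f : 𝔐 →L[ℂ] ℂ} (hf : ‖f‖ ≤ 1) (h1 : f 1 = 1)
    {X : 𝔐} (hX : IsSelfAdjoint X) : (f X).im = 0 := by
  have : Nontrivial 𝔐 := ⟨1, 0, fun h => by simp [h] at h1⟩
  have key : ∀ t : ℝ, (f X).im ^ 2 + 2 * (f X).im * t ≤ ‖X‖ ^ 2 := by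
    intro t
    set Z : 𝔐 := X + ((t : ℂ) * Complex.I) • (1 : 𝔐) with hZ
    have hfZ : f Z = f X + (t : ℂ) * Complex.I := by simp [hZ, h1]
    have hZZ : star Z * Z = X * X + ((t : ℂ) ^ 2) • (1 : 𝔐) := by
      simp only [hZ, star_add, hX.star_eq, star_smul, star_one, add_mul, mul_add, smul_mul_assoc,
        mul_smul_comm, one_mul, mul_one, smul_add, smul_smul]
      simp only [star_mul', RCLike.star_def, Complex.conj_ofReal, Complex.conj_I]
      have : (t : ℂ) * Complex.I * (t * -Complex.I) = (t : ℂ) ^ 2 := by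
        linear_combination (-(t : ℂ) ^ 2) * Complex.I_mul_I
      rw [this]
      module
    have hn : ‖Z‖ ^ 2 ≤ ‖X‖ ^ 2 + t ^ 2 := by
      rw [sq ‖Z‖, ← CStarRing.norm_star_mul_self, hZZ]
      refine (norm_add_le _ _).trans (add_le_add ?_ ?_)
      · rw [sq]; exact norm_mul_le _ _
      · simp [norm_smul]
    have h2 : ‖f Z‖ ≤ ‖Z‖ := by
      simpa using f.le_of_opNorm_le hf Z
    have h3 : ‖f Z‖ ^ 2 = (f X).re ^ 2 + ((f X).im + t) ^ 2 := by
      rw [hfZ, Complex.sq_norm, Complex.normSq_apply]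
      simp [sq]
    nlinarith [pow_le_pow_left₀ (norm_nonneg _) h2 2, sq_nonneg (f X).re]
  by_contra hne
  have := key (‖X‖ ^ 2 / (2 * (f X).im))
  rw [mul_div_cancel₀ _ (mul_ne_zero two_ne_zero hne)] at this
  have : 0 < (f X).im ^ 2 := by positivity
  linarith

/-- A contractive unital functional on a C⋆-algebra is positive. -/
theorem apply_nonneg_of_norm_le_one {f : 𝔐 →L[ℂ] ℂ} (hf : ‖f‖ ≤ 1) (h1 : f 1 = 1)
    {X : 𝔐} (hX : 0 ≤ X) : 0 ≤ f X := by
  have hsa : IsSelfAdjoint X := .of_nonneg hX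
  have him := im_apply_eq_zero_of_norm_le_one hf h1 hsa
  have hn : ‖algebraMap ℝ 𝔐 ‖X‖ - X‖ ≤ ‖X‖ := by
    have h0 : 0 ≤ algebraMap ℝ 𝔐 ‖X‖ - X := sub_nonneg.2 hsa.le_algebraMap_norm_self
    rw [CStarAlgebra.norm_le_iff_le_algebraMap _ (norm_nonneg _) h0]
    exact sub_le_self _ hX
  have hv : f (algebraMap ℝ 𝔐 ‖X‖ - X) = (‖X‖ : ℂ) - f X := by
    rw [map_sub, Algebra.algebraMap_eq_smul_one, ← Complex.coe_smul, map_smul, h1]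
    simp
  have h2 : ‖f (algebraMap ℝ 𝔐 ‖X‖ - X)‖ ≤ ‖X‖ :=
    (f.le_of_opNorm_le hf _).trans (by simpa only [one_mul] using hn)
  rw [hv] at h2
  have h3 := (Complex.re_le_norm _).trans h2
  rw [Complex.sub_re, Complex.ofReal_re] at h3
  rw [Complex.nonneg_iff]
  exact ⟨by linarith, him.symm⟩

/-- A non-invertible element of a C⋆-algebra is annihilated by a contractive unital functional:
`1` has distance at least `1` from `ℂ B`, since `1` lies in the spectrum of `1 + c B`. -/
theorem exists_norm_le_one_apply_eq_zero {𝔐 : Type*} [CStarAlgebra 𝔐] [Nontrivial 𝔐]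
    {B : 𝔐} (hB : ¬ IsUnit B) :
    ∃ f : 𝔐 →L[ℂ] ℂ, ‖f‖ ≤ 1 ∧ f 1 = 1 ∧ f B = 0 := by
  let S : Submodule ℂ 𝔐 := Submodule.span ℂ {B}
  have hS : IsClosed (S : Set 𝔐) := Submodule.closed_of_finiteDimensional S
  have hn : ‖(S.mkQ 1 : 𝔐 ⧸ S)‖ = 1 := by
    refine le_antisymm ((Submodule.Quotient.norm_mk_le S 1).trans (by simp)) ?_
    refine (QuotientAddGroup.le_norm_iff (S := S.toAddSubgroup)).2 fun m hm => ?_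
    have hm' : m - 1 ∈ S := (Submodule.Quotient.eq S).1 hm
    obtain ⟨c, hc⟩ := Submodule.mem_span_singleton.1 hm'
    have h1 : (1 : ℂ) ∈ spectrum ℂ m := by
      rw [spectrum.mem_iff, map_one, show (1 : 𝔐) - m = (-c) • B by rw [neg_smul, hc]; abel]
      intro h
      rcases eq_or_ne c 0 with rfl | h0
      · simp at h
      · exact hB ((isUnit_smul_iff (Units.mk0 (-c) (neg_ne_zero.2 h0)) B).1 h)
    simpa using spectrum.norm_le_norm_of_mem h1
  obtain ⟨g, hg, hg1⟩ := exists_dual_vector'' ℂ (S.mkQ 1 : 𝔐 ⧸ S)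
  let q : 𝔐 →L[ℂ] 𝔐 ⧸ S := S.mkQ.mkContinuous 1 fun x => by
    simpa using Submodule.Quotient.norm_mk_le S x
  refine ⟨g.comp q, ?_, ?_, ?_⟩
  · exact (g.opNorm_comp_le q).trans
      (mul_le_one₀ hg (norm_nonneg _) (LinearMap.mkContinuous_norm_le _ zero_le_one _))
  · change g (S.mkQ 1) = 1
    rw [hg1, hn]; simp
  · change g (S.mkQ B) = 0
    rw [Submodule.mkQ_apply, (Submodule.Quotient.mk_eq_zero S).2
      (Submodule.mem_span_singleton_self B), map_zero]

/-- A bounded functional, positive on the positive cone, as a `PositiveLinearMap`. -/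
noncomputable def toPositive (f : 𝔐 →L[ℂ] ℂ) (hf : ∀ X, 0 ≤ X → 0 ≤ f X) : 𝔐 →ₚ[ℂ] ℂ :=
  PositiveLinearMap.mk₀ f.toLinearMap hf

/-- Cauchy–Schwarz: a positive functional killing `Y⋆ Y` kills the left ideal generated by `Y`. -/
theorem apply_mul_eq_zero {f : 𝔐 →L[ℂ] ℂ} (hf : ∀ X, 0 ≤ X → 0 ≤ f X) {Y : 𝔐}
    (hY : f (star Y * Y) = 0) (X : 𝔐) : f (X * Y) = 0 := by
  let p := toPositive f hf
  have h := norm_inner_le_norm (𝕜 := ℂ) (p.toPreGNS (star X)) (p.toPreGNS Y)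
  have h0 : ‖p.toPreGNS Y‖ = 0 := by
    rw [p.preGNS_norm_def]
    change √(f (star Y * Y)).re = 0
    simp [hY]
  rw [h0, mul_zero, norm_le_zero_iff] at h
  have h' : f (star (star X) * Y) = 0 := h
  rwa [star_star] at h'

/-- A positive functional is bounded by `4 f(1)`. The constant is not sharp, but makes the set of
states bounded. -/
theorem norm_apply_le_four {f : 𝔐 →L[ℂ] ℂ} (hf : ∀ X, 0 ≤ X → 0 ≤ f X) (X : 𝔐) :
    ‖f X‖ ≤ 4 * ‖f 1‖ * ‖X‖ := by
  obtain ⟨y, hy0, hyn, hy⟩ := CStarAlgebra.exists_sum_four_nonneg X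
  conv_lhs => rw [hy]
  rw [map_sum]
  refine (norm_sum_le _ _).trans ((Finset.sum_le_card_nsmul _ _ (‖f 1‖ * ‖X‖) ?_).trans_eq ?_)
  · intro i _
    rw [map_smul, norm_smul]
    simp only [norm_pow, Complex.norm_I, one_pow, one_mul]
    refine ((toPositive f hf).norm_apply_le_of_nonneg _ (hy0 i)).trans ?_
    exact mul_le_mul_of_nonneg_left (hyn i) (norm_nonneg _)
  · simp; ring

/-! ### Pure states killing a proper left ideal -/

/-- The states of a C⋆-algebra that vanish on `B`. -/
def statesVanishing (B : 𝔐) : Set (WeakDual ℂ 𝔐) :=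
  {f | (∀ X, 0 ≤ X → 0 ≤ f X) ∧ f 1 = 1 ∧ f B = 0}

theorem isCompact_statesVanishing (B : 𝔐) : IsCompact (statesVanishing B) := by
  apply WeakDual.isCompact_of_bounded_of_closed
  · refine (WeakDual.isBounded_closedBall (𝕜 := ℂ) (E := 𝔐) 0 4).subset ?_
    rintro f ⟨hf, h1, -⟩
    rw [Set.mem_preimage, mem_closedBall_zero_iff]
    refine ContinuousLinearMap.opNorm_le_bound _ (by norm_num) fun X => ?_
    simpa [show WeakDual.toStrongDual f 1 = 1 from h1] using
      norm_apply_le_four (f := WeakDual.toStrongDual f) hf X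
  · have e : statesVanishing B = (⋂ X : 𝔐, ⋂ _ : 0 ≤ X, {f : WeakDual ℂ 𝔐 | 0 ≤ f X}) ∩
        ({f | f 1 = 1} ∩ {f | f B = 0}) := by
      ext f; simp [statesVanishing]
    rw [e]
    refine IsClosed.inter (isClosed_iInter fun X => isClosed_iInter fun _ => ?_) (.inter ?_ ?_)
    · exact isClosed_Ici.preimage (WeakDual.eval_continuous X)
    · exact isClosed_eq (WeakDual.eval_continuous _) continuous_const
    · exact isClosed_eq (WeakDual.eval_continuous _) continuous_const

/-- If `Y⋆ Y` is not invertible, some pure state kills the left ideal generated by `Y`. It is found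
by Krein–Milman as an extreme point of the weak-⋆ compact face of states vanishing on `Y⋆ Y`. -/
theorem exists_pure_apply_mul_eq_zero [Nontrivial 𝔐] {Y : 𝔐} (hY : ¬ IsUnit (star Y * Y)) :
    ∃ f : 𝔐 →L[ℂ] ℂ, (∀ X, 0 ≤ X → 0 ≤ f X) ∧ f 1 = 1 ∧ (∀ X, f (X * Y) = 0) ∧
      ∀ p : 𝔐 →L[ℂ] ℂ, (∀ X, 0 ≤ X → 0 ≤ p X) → (∀ X, 0 ≤ X → p X ≤ f X) →
        ∃ α : ℝ, 0 ≤ α ∧ α ≤ 1 ∧ p = (α : ℂ) • f := by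
  have : LocallyConvexSpace ℝ (WeakDual ℂ 𝔐) :=
    inferInstanceAs (LocallyConvexSpace ℝ (WeakBilin _))
  have hne : (statesVanishing (star Y * Y)).Nonempty := by
    obtain ⟨f, hf, h1, h0⟩ := exists_norm_le_one_apply_eq_zero hY
    exact ⟨StrongDual.toWeakDual f, fun X hX => apply_nonneg_of_norm_le_one hf h1 hX, h1, h0⟩
  obtain ⟨f', hf'⟩ := (isCompact_statesVanishing (star Y * Y)).extremePoints_nonempty hne
  obtain ⟨⟨hpos, h1, h0⟩, hext⟩ := mem_extremePoints.1 hf'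
  obtain ⟨f, rfl⟩ : ∃ f : 𝔐 →L[ℂ] ℂ, StrongDual.toWeakDual f = f' := ⟨WeakDual.toStrongDual f', rfl⟩
  replace hpos : ∀ X, 0 ≤ X → 0 ≤ f X := hpos
  replace h1 : f 1 = 1 := h1
  replace h0 : f (star Y * Y) = 0 := h0
  refine ⟨f, hpos, h1, apply_mul_eq_zero hpos h0, fun p hp hle => ?_⟩
  have hzero : ∀ q : 𝔐 →L[ℂ] ℂ, (∀ X, 0 ≤ X → 0 ≤ q X) → q 1 = 0 → q = 0 := by
    intro q hq hq1
    ext X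
    simpa [hq1] using norm_apply_le_four hq X
  set t : ℝ := (p 1).re with ht
  have hpt : p 1 = (t : ℂ) := by
    exact Complex.ext rfl (Complex.nonneg_iff.1 (hp 1 zero_le_one)).2.symm
  have hr : ∀ X, 0 ≤ X → 0 ≤ (f - p) X := fun X hX => sub_nonneg.2 (hle X hX)
  have ht0 : 0 ≤ t := (Complex.nonneg_iff.1 (hp 1 zero_le_one)).1
  have ht1 : t ≤ 1 := by
    have := hle 1 zero_le_one
    rw [h1, hpt] at this
    exact_mod_cast this
  refine ⟨t, ht0, ht1, ?_⟩
  -- For `0 < t < 1`, `f` is the convex combination of the states `p / t` and `(f - p) / (1 - t)`,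
  -- both of which vanish on `Y⋆ Y`.
  rcases ht0.eq_or_lt with h | hpos0
  · rw [hzero p hp (by rw [hpt, ← h]; simp), ← h, Complex.ofReal_zero]; exact (zero_smul ℂ f).symm
  rcases ht1.eq_or_lt with h | hlt1
  · have := hzero (f - p) hr (by simp [h1, hpt, h])
    rw [h]
    simpa using (sub_eq_zero.1 this).symm
  have hB : p (star Y * Y) = 0 :=
    le_antisymm ((hle _ (star_mul_self_nonneg Y)).trans_eq h0) (hp _ (star_mul_self_nonneg Y))
  have hs0 : 0 < 1 - t := sub_pos.2 hlt1
  have hmem : ∀ (q : 𝔐 →L[ℂ] ℂ) (s : ℝ), (∀ X, 0 ≤ X → 0 ≤ q X) → 0 < s → q 1 = (s : ℂ) →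
      q (star Y * Y) = 0 →
      StrongDual.toWeakDual (((s⁻¹ : ℝ) : ℂ) • q) ∈ statesVanishing (star Y * Y) := by
    intro q s hq hs hq1 hqB
    refine ⟨fun X hX => ?_, ?_, ?_⟩
    · change 0 ≤ ((s⁻¹ : ℝ) : ℂ) * q X
      exact mul_nonneg (by exact_mod_cast (inv_pos.2 hs).le) (hq X hX)
    · change ((s⁻¹ : ℝ) : ℂ) * q 1 = 1
      rw [hq1]; exact_mod_cast inv_mul_cancel₀ hs.ne'
    · change ((s⁻¹ : ℝ) : ℂ) * q _ = 0
      rw [hqB, mul_zero]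
  have hm1 := hmem p t hp hpos0 hpt hB
  have hm2 := hmem (f - p) (1 - t) hr hs0 (by simp [h1, hpt]) (by simp [h0, hB])
  have hseg : StrongDual.toWeakDual f ∈ openSegment ℝ
      (StrongDual.toWeakDual (((t⁻¹ : ℝ) : ℂ) • p))
      (StrongDual.toWeakDual ((((1 - t)⁻¹ : ℝ) : ℂ) • (f - p))) := by
    refine ⟨t, 1 - t, hpos0, hs0, by ring, ?_⟩
    apply DFunLike.ext
    intro X
    change t • (((t⁻¹ : ℝ) : ℂ) * p X) + (1 - t) • ((((1 - t)⁻¹ : ℝ) : ℂ) * (f X - p X)) = f X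
    have c1 : (t : ℂ) ≠ 0 := by exact_mod_cast hpos0.ne'
    have c2 : ((1 - t : ℝ) : ℂ) ≠ 0 := by exact_mod_cast hs0.ne'
    rw [Complex.real_smul, Complex.real_smul, Complex.ofReal_inv, Complex.ofReal_inv,
      mul_inv_cancel_left₀ c1, mul_inv_cancel_left₀ c2]
    ring
  have hfin := (hext _ hm1 _ hm2 hseg).1
  have hfin' : ((t⁻¹ : ℝ) : ℂ) • p = f := StrongDual.toWeakDual_inj _ _ |>.1 hfin
  rw [← hfin', smul_smul]
  have : (t : ℂ) * ((t⁻¹ : ℝ) : ℂ) = 1 := by exact_mod_cast mul_inv_cancel₀ hpos0.ne'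
  rw [this, one_smul]

/-! ### The support projection -/

/-- If `σ(A) \ {0}` is closed, the positive element `A` has a square root `Q` with a
pseudo-inverse `R`; the product `Q R` is the support projection of `A`. -/
theorem exists_sqrt_pseudoinverse {A : 𝔐} (hA : 0 ≤ A) (hc : IsClosed (spectrum ℂ A \ {0})) :
    ∃ Q R : 𝔐, 0 ≤ Q ∧ Q * Q = A ∧ IsSelfAdjoint R ∧ Q * R = R * Q ∧ Q * R * Q = Q := by
  have hsa : IsSelfAdjoint A := .of_nonneg hA
  have hnn : ∀ x ∈ spectrum ℝ A, 0 ≤ x := fun x hx => spectrum_nonneg_of_nonneg hA hx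
  have hcr : IsClosed (spectrum ℝ A \ {0}) := by
    have : spectrum ℝ A \ {0} = (fun x : ℝ => (x : ℂ)) ⁻¹' (spectrum ℂ A \ {0}) := by
      ext x
      rw [← spectrum.preimage_algebraMap ℂ]
      simp
    rw [this]
    exact hc.preimage Complex.continuous_ofReal
  have hs : ContinuousOn Real.sqrt (spectrum ℝ A) := Real.continuous_sqrt.continuousOn
  have hi : ContinuousOn (fun x : ℝ => (Real.sqrt x)⁻¹) (spectrum ℝ A) := by
    intro x hx
    -- `x⁻¹` has the junk value `0` at `0`, which is harmless because `0` is isolated in the spectrum.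
    rcases eq_or_ne x 0 with rfl | h0
    · have : (spectrum ℝ A \ {0})ᶜ ∈ nhds (0 : ℝ) := hcr.isOpen_compl.mem_nhds (by simp)
      refine continuousWithinAt_const (b := (Real.sqrt 0)⁻¹) |>.congr_of_eventuallyEq ?_ rfl
      filter_upwards [mem_nhdsWithin_of_mem_nhds this, self_mem_nhdsWithin] with y hy hyA
      have : y = 0 := by by_contra h; exact hy ⟨hyA, h⟩
      subst this; rfl
    · have hpos : 0 < x := lt_of_le_of_ne (hnn x hx) h0.symm
      exact (Real.continuous_sqrt.continuousAt.inv₀ (Real.sqrt_pos.2 hpos).ne').continuousWithinAt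
  refine ⟨cfc Real.sqrt A, cfc (fun x : ℝ => (Real.sqrt x)⁻¹) A, ?_, ?_, ?_, ?_, ?_⟩
  · exact cfc_nonneg fun x _ => Real.sqrt_nonneg x
  · rw [← cfc_mul _ _ A hs hs]
    conv_rhs => rw [← cfc_id ℝ A]
    exact cfc_congr fun x hx => Real.mul_self_sqrt (hnn x hx)
  · exact cfc_predicate _ A
  · exact (cfc_commute_cfc _ _ A).eq
  · rw [← cfc_mul _ _ A hs hi,
      ← cfc_mul (fun x => Real.sqrt x * (Real.sqrt x)⁻¹) _ A (hs.mul hi) hs]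
    exact cfc_congr fun x _ => mul_inv_mul_cancel _

end StarAlgebra

/-! ### Invertibility and pure functionals in the corner of the support -/

section Support

/-- `Q` is a self-adjoint square root of `A`, and `R` a self-adjoint pseudo-inverse of `Q` commuting
with it. Then `Q * R` is the support projection of `A`. -/
structure IsPseudoSqrt {𝔐 : Type*} [CStarAlgebra 𝔐] (A Q R : 𝔐) : Prop where
  mul_self : Q * Q = A
  star_left : star Q = Q
  star_right : star R = R
  comm : Q * R = R * Q
  mul_mul_self : Q * R * Q = Q

variable {𝔐 : Type*} [CStarAlgebra 𝔐] {A Q R D : 𝔐}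

namespace IsPseudoSqrt

theorem star_support (h : IsPseudoSqrt A Q R) : star (Q * R) = Q * R := by
  rw [star_mul, h.star_left, h.star_right, h.comm]

theorem mul_support (h : IsPseudoSqrt A Q R) : Q * (Q * R) = Q := by
  rw [h.comm, ← mul_assoc, h.mul_mul_self]

theorem support_mul_support (h : IsPseudoSqrt A Q R) : Q * R * (Q * R) = Q * R := by
  rw [← mul_assoc, h.mul_mul_self]

theorem mul_support_of_mul_self (h : IsPseudoSqrt A Q R) : A * (Q * R) = A := by
  rw [← h.mul_self, mul_assoc, h.mul_support]

theorem support_mul_of_mul_self (h : IsPseudoSqrt A Q R) : Q * R * A = A := by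
  rw [← h.mul_self, ← mul_assoc, h.mul_mul_self]

theorem isUnit_add_one_sub_support (h : IsPseudoSqrt A Q R) : IsUnit (A + (1 - Q * R)) := by
  have hAP := h.mul_support_of_mul_self
  have hPA := h.support_mul_of_mul_self
  have hPP := h.support_mul_support
  have hRR : Commute Q R := h.comm
  have hAR : A * (R * R) = Q * R := by
    rw [← h.mul_self, hRR.mul_mul_mul_comm, hPP]
  have hPR : Q * R * (R * R) = R * R * (Q * R) :=
    (((hRR.mul_right hRR).mul_left ((Commute.refl R).mul_right (Commute.refl R)))).eq
  have hRA : R * R * A = Q * R := by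
    rw [← hAR, ← h.mul_self]
    exact (((hRR.mul_right hRR).mul_left (hRR.mul_right hRR)).eq).symm
  generalize Q * R = P at *
  -- The inverse of `A` in the corner of its support projection `P` is `J`.
  obtain ⟨J, hJ⟩ : ∃ J, J = R * R * P := ⟨_, rfl⟩
  have hAJ : A * J = P := by rw [hJ, ← mul_assoc, hAR, hPP]
  have hJA : J * A = P := by rw [hJ, mul_assoc, hPA, hRA]
  have hJP : J * P = J := by rw [hJ, mul_assoc, hPP]
  have hPJ : P * J = J := by rw [hJ, ← mul_assoc, hPR, mul_assoc, hPP]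
  refine isUnit_iff_exists.2 ⟨J + (1 - P), ?_, ?_⟩
  · simp only [add_mul, mul_add, sub_mul, mul_sub, mul_one, one_mul, hAJ, hAP, hPJ, hPP]
    abel
  · simp only [add_mul, mul_add, sub_mul, mul_sub, mul_one, one_mul, hJA, hPA, hJP, hPP]
    abel

/-- If the compression of `D` to the support of `A` is invertible in the corner, its inverse `V`
there is an `A`-inverse of `D`. -/
theorem exists_corner_inverse (h : IsPseudoSqrt A Q R) (hD : Q * R * D = Q * R * D * (Q * R))
    (hu : IsUnit (Q * R * D * (Q * R) + (1 - Q * R))) :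
    ∃ V, V * (Q * R) = V ∧ Q * R * V = V ∧ A * D * V = A ∧ A * V * D = A := by
  have h1 := h.mul_support_of_mul_self
  have h3 := h.support_mul_support
  generalize Q * R = P at *
  obtain ⟨U, hU1, hU2⟩ := isUnit_iff_exists.1 hu
  set Y := P * D * P + (1 - P) with hY
  have hPY : P * Y = P * D := by
    rw [hY, mul_add, mul_sub, mul_one, h3, sub_self, add_zero, ← hD, ← mul_assoc, h3]
  have hYP : Y * P = P * D := by
    rw [hY, add_mul, sub_mul, one_mul, h3, sub_self, add_zero, mul_assoc, h3, ← hD]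
  have hUP : U * P = P * U := by
    calc U * P = U * P * (Y * U) := by rw [hU1, mul_one]
      _ = U * (P * Y) * U := by simp only [mul_assoc]
      _ = (U * Y) * (P * U) := by rw [hPY, ← hYP]; simp only [mul_assoc]
      _ = P * U := by rw [hU2, one_mul]
  refine ⟨U * P, by rw [mul_assoc, h3], by rw [hUP, ← mul_assoc, h3], ?_, ?_⟩
  · calc A * D * (U * P) = A * (P * D) * (U * P) := by rw [← mul_assoc A P D, h1]
      _ = A * (P * (Y * U) * P) := by rw [← hPY]; simp only [mul_assoc]
      _ = A := by rw [hU1, mul_one, h3, h1]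
  · calc A * (U * P) * D = A * U * (P * D) := by simp only [mul_assoc]
      _ = A * (U * Y * P) := by rw [← hYP]; simp only [mul_assoc]
      _ = A := by rw [hU2, one_mul, h1]

variable [PartialOrder 𝔐] [StarOrderedRing 𝔐]

/-- If `Z` is the identity off the support of `A` and is not left invertible, then the pure state
killing the left ideal of `Z` lives on the support of `A`; there `A` is invertible, so the state can
be rescaled to take the value `1` at `A`. -/
theorem exists_pure (h : IsPseudoSqrt A Q R) [Nontrivial 𝔐] {Z : 𝔐}
    (hZ : (1 - Q * R) * Z = 1 - Q * R) (hZu : ¬ IsUnit (star Z * Z)) :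
    ∃ τ : 𝔐 →L[ℂ] ℂ, (∀ X, 0 ≤ X → 0 ≤ τ X) ∧ τ A = 1 ∧ (∀ X, τ (X * Z) = 0) ∧
      ∀ p : 𝔐 →L[ℂ] ℂ, (∀ X, 0 ≤ X → 0 ≤ p X) → (∀ X, 0 ≤ X → p X ≤ τ X) →
        ∃ α : ℝ, 0 ≤ α ∧ α ≤ 1 ∧ p = (α : ℂ) • τ := by
  obtain ⟨f, hf, h1, h0, hp⟩ := exists_pure_apply_mul_eq_zero hZu
  have hA' : A = star Q * Q := by rw [h.star_left, h.mul_self]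
  have hA0 : f A ≠ 0 := by
    intro hfA
    have e1 : f (Q * R) = 0 := by
      rw [h.comm]; exact apply_mul_eq_zero hf (by rw [← hA', hfA]) R
    have e2 : f (1 - Q * R) = 0 := by rw [← hZ]; exact h0 _
    rw [map_sub, e1, h1] at e2
    simp at e2
  have hAnn : 0 ≤ f A := hf A (by rw [hA']; exact star_mul_self_nonneg Q)
  obtain ⟨c, hc⟩ : ∃ c : ℝ, f A = (c : ℂ) := ⟨_, Complex.eq_re_of_ofReal_le hAnn⟩
  have hc0 : 0 < c := by
    refine lt_of_le_of_ne ?_ ?_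
    · rw [hc] at hAnn; exact_mod_cast hAnn
    · rintro rfl; exact hA0 (by simpa using hc)
  have hcC : (c : ℂ) ≠ 0 := by exact_mod_cast hc0.ne'
  have hcn : (0 : ℂ) ≤ (c : ℂ) := by exact_mod_cast hc0.le
  have hin : (0 : ℂ) ≤ (c : ℂ)⁻¹ := by exact_mod_cast (inv_pos.2 hc0).le
  refine ⟨(c : ℂ)⁻¹ • f, fun X hX => ?_, ?_, fun X => ?_, fun p hpp hle => ?_⟩
  · exact mul_nonneg hin (hf X hX)
  · change (c : ℂ)⁻¹ * f A = 1
    rw [hc, inv_mul_cancel₀ hcC]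
  · change (c : ℂ)⁻¹ * f (X * Z) = 0
    rw [h0, mul_zero]
  · obtain ⟨α, hα0, hα1, hα⟩ := hp ((c : ℂ) • p) (fun X hX => mul_nonneg hcn (hpp X hX))
      (fun X hX => by
        have := mul_le_mul_of_nonneg_left (hle X hX) hcn
        change (c : ℂ) * p X ≤ (c : ℂ) * ((c : ℂ)⁻¹ * f X) at this
        rwa [mul_inv_cancel_left₀ hcC] at this)
    refine ⟨α, hα0, hα1, ?_⟩
    rw [smul_comm, ← hα, smul_smul, inv_mul_cancel₀ hcC, one_smul]

/-- If the compression `Y` of `D` to the support of `A` is not invertible in the corner, then either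
`Y` is not left invertible, or `A Y` is not right invertible; the corresponding proper one-sided
ideal is killed by an `A`-pure functional. -/
theorem exists_pure_of_not_isUnit (h : IsPseudoSqrt A Q R) [Nontrivial 𝔐]
    (hD : Q * R * D = Q * R * D * (Q * R))
    (hu : ¬ IsUnit (Q * R * D * (Q * R) + (1 - Q * R))) :
    ∃ τ : 𝔐 →L[ℂ] ℂ, ((∀ X, 0 ≤ X → 0 ≤ τ X) ∧ τ A = 1 ∧
      ∀ p : 𝔐 →L[ℂ] ℂ, (∀ X, 0 ≤ X → 0 ≤ p X) → (∀ X, 0 ≤ X → p X ≤ τ X) →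
        ∃ α : ℝ, 0 ≤ α ∧ α ≤ 1 ∧ p = (α : ℂ) • τ) ∧
      ((∀ S, S * (Q * R) = S → τ (A * S * D) = 0) ∨
        ∀ S, Q * R * S = S → τ (A * D * S) = 0) := by
  have h1 := h.mul_support_of_mul_self
  have h2 := h.support_mul_of_mul_self
  have h3 := h.support_mul_support
  have hsP := h.star_support
  have hA : star A = A := by rw [← h.mul_self, star_mul, h.star_left]
  have hA'u := h.isUnit_add_one_sub_support
  have hpure := @exists_pure _ _ A Q R _ _ h _
  generalize Q * R = P at *
  set Y := P * D * P + (1 - P) with hY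
  have hPY : P * Y = P * D := by
    rw [hY, mul_add, mul_sub, mul_one, h3, sub_self, add_zero, ← hD, ← mul_assoc, h3]
  have hYP : Y * P = P * D := by
    rw [hY, add_mul, sub_mul, one_mul, h3, sub_self, add_zero, mul_assoc, h3, ← hD]
  have hYadd : Y = P * D + (1 - P) := by rw [hY, ← hD]
  have hZ1 : (1 - P) * Y = 1 - P := by
    rw [sub_mul, one_mul, hPY, hYadd]; abel
  by_cases hl : IsUnit (star Y * Y)
  · -- `Y` is left invertible, so it cannot also be right invertible, nor can `(A + (1 - P)) * Y`.
    have hr : ¬ IsUnit (star (star Y * (A + (1 - P))) * (star Y * (A + (1 - P)))) := by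
      intro hr
      apply hu
      have hs : star (star Y * (A + (1 - P))) = (A + (1 - P)) * Y := by
        rw [star_mul, star_star, star_add, star_sub, star_one, hsP, hA]
      rw [hs] at hr
      obtain ⟨b, hb⟩ := hl.exists_left_inv
      obtain ⟨c, hc⟩ := hr.exists_right_inv
      rw [mul_assoc, mul_assoc] at hc
      obtain ⟨u, hu'⟩ := hA'u
      have hYc : Y * ((star Y * (A + (1 - P))) * c * (A + (1 - P))) = 1 := by
        rw [← hu'] at hc ⊢
        have := congrArg (fun x => (↑u⁻¹ : 𝔐) * x * u) hc
        simpa [mul_assoc] using this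
      exact isUnit_iff_exists_and_exists.2 ⟨⟨_, hYc⟩, ⟨b * star Y, by rwa [mul_assoc]⟩⟩
    obtain ⟨τ, hpos, hτA, hτ, hτp⟩ := hpure (Z := star Y * (A + (1 - P))) (by
      have : (1 - P) * star Y = 1 - P := by
        have e : Y * (1 - P) = 1 - P := by rw [mul_sub, mul_one, hYP, hYadd]; abel
        simpa [hsP] using congrArg star e
      rw [← mul_assoc, this, sub_mul, one_mul, mul_add, h2, mul_sub, mul_one, h3]; abel) hr
    refine ⟨τ, ⟨hpos, hτA, hτp⟩, .inr fun S hS => ?_⟩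
    have e : A * D * S = star (star S * (star Y * (A + (1 - P)))) := by
      rw [star_mul, star_mul, star_star, star_star, star_add, star_sub, star_one, hsP, hA]
      calc A * D * S = A * (P * D) * S := by rw [← mul_assoc A P D, h1]
        _ = (A + (1 - P)) * P * Y * S := by
          rw [add_mul, sub_mul, one_mul, h3, sub_self, add_zero, h1, ← hPY, ← mul_assoc A P Y, h1]
        _ = (A + (1 - P)) * (Y * P) * S := by rw [hYP, ← hPY]; simp only [mul_assoc]
        _ = (A + (1 - P)) * Y * S := by rw [mul_assoc, mul_assoc Y, hS, mul_assoc]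
    have := map_star (toPositive τ hpos) (star S * (star Y * (A + (1 - P))))
    change τ _ = star (τ _) at this
    rw [e, this, hτ, star_zero]
  · obtain ⟨τ, hpos, hτA, hτ, hτp⟩ := hpure hZ1 hl
    refine ⟨τ, ⟨hpos, hτA, hτp⟩, .inl fun S hS => ?_⟩
    have e : A * S * D = A * S * Y := by
      rw [← hS, mul_assoc A, mul_assoc A, mul_assoc S, mul_assoc S, hPY]
    rw [e, hτ]

end IsPseudoSqrt

end Support

/-! ### The `A`-spectrum in a von Neumann algebra -/

section VonNeumann

variable {H : Type*} [NormedAddCommGroup H] [InnerProductSpace ℂ H] [CompleteSpace H]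

/-- A von Neumann algebra is norm closed, being its own bicommutant; so `Elt M` is a C⋆-algebra. -/
instance isClosed_coe (M : VonNeumannAlgebra H) :
    IsClosed (M.toStarSubalgebra : Set (H →L[ℂ] H)) := by
  rw [VonNeumannAlgebra.coe_toStarSubalgebra, ← M.centralizer_centralizer]
  exact Set.isClosed_centralizer _

variable {M : VonNeumannAlgebra H}

/-- An element of `M` that is positive as an operator has a self-adjoint square root inside `M`,
since its spectrum in `M` agrees with its spectrum as an operator. -/
theorem IsPos.exists_eq_star_mul_self {X : Elt M} (hX : IsPos X) : ∃ S : Elt M, X = star S * S := by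
  have hX' : 0 ≤ (X : H →L[ℂ] H) := hX
  have hsa : IsSelfAdjoint X := Subtype.ext (IsSelfAdjoint.of_nonneg hX').star_eq
  have hnn : ∀ x ∈ spectrum ℝ X, 0 ≤ x := by
    intro x hx
    rw [← spectrum.preimage_algebraMap ℂ, Set.mem_preimage, StarSubalgebra.spectrum_eq] at hx
    rw [← Set.mem_preimage, spectrum.preimage_algebraMap] at hx
    exact spectrum_nonneg_of_nonneg hX' hx
  have hc : ContinuousOn Real.sqrt (spectrum ℝ X) := Real.continuous_sqrt.continuousOn
  refine ⟨cfc Real.sqrt X, ?_⟩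
  rw [(cfc_predicate Real.sqrt X : IsSelfAdjoint _).star_eq, ← cfc_mul _ _ X hc hc]
  conv_lhs => rw [← cfc_id ℝ X]
  exact cfc_congr fun x hx => (Real.mul_self_sqrt (hnn x hx)).symm

/-- The order that `Elt M` inherits from the operators on `H` is its order as a C⋆-algebra. -/
instance starOrderedRing_elt : StarOrderedRing (Elt M) :=
  .of_nonneg_iff' (fun {x y} hxy z => add_le_add_right (α := H →L[ℂ] H) hxy (z : H →L[ℂ] H))
    fun X => ⟨fun hX => IsPos.exists_eq_star_mul_self hX, by
      rintro ⟨S, rfl⟩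
      exact star_mul_self_nonneg (S : H →L[ℂ] H)⟩

theorem sqrtOp_eq {A Q : Elt M} (hQ : 0 ≤ Q) (hQA : Q * Q = A) : sqrtOp A = (Q : H →L[ℂ] H) :=
  CFC.sqrt_unique (congrArg Subtype.val hQA) hQ

theorem mem_aBounded_iff {A Q T : Elt M} (hQ : 0 ≤ Q) (hQA : Q * Q = A) :
    T ∈ aBounded A ↔ ∃ S : Elt M, Q * S = star T * Q := by
  simp only [aBounded, Set.mem_ofPred_eq, sqrtOp_eq hQ hQA, Subtype.ext_iff]
  rfl

theorem mem_halfCorner_iff {A Q S : Elt M} (hQ : 0 ≤ Q) (hQA : Q * Q = A) :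
    S ∈ halfCorner A ↔ ∃ X : Elt M, S = Q * X * Q := by
  simp only [halfCorner, Set.mem_ofPred_eq, sqrtOp_eq hQ hQA, Subtype.ext_iff]
  rfl

/-- Membership of `T` in `M^A` says that `T` maps the kernel of `A` into itself. -/
theorem support_mul_of_mem_aBounded {A Q R T : Elt M} (h : IsPseudoSqrt A Q R) (hQ : 0 ≤ Q)
    (hT : T ∈ aBounded A) : Q * R * T = Q * R * T * (Q * R) := by
  obtain ⟨S, hS⟩ := (mem_aBounded_iff hQ h.mul_self).1 hT
  have e : Q * R * (star T * (Q * R)) = star T * (Q * R) := by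
    rw [← mul_assoc (star T), ← hS, ← mul_assoc, ← mul_assoc, h.mul_mul_self]
  have := congrArg star e
  simp only [star_mul, star_star, h.star_left, h.star_right, ← h.comm] at this
  exact this.symm

/-- The `A`-spectrum of `T` is the set of values at `A T` of the `A`-pure functionals that are
multiplicative against `T` on one side. -/
theorem aSpectrum_eq {A T : Elt M} (hA0 : A ≠ 0) (hA : IsPos A) (hws : WellSupported A)
    (hT : T ∈ aBounded A) :
    aSpectrum A T = {z : ℂ | ∃ g ∈ pureMult A T, g (A * T) = z} := by
  have : Nontrivial (Elt M) := ⟨A, 0, hA0⟩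
  obtain ⟨Q, R, hQ, hQA, hR, hcomm, hQRQ⟩ := exists_sqrt_pseudoinverse (A := A) hA hws
  have h : IsPseudoSqrt A Q R :=
    ⟨hQA, (IsSelfAdjoint.of_nonneg hQ).star_eq, hR.star_eq, hcomm, hQRQ⟩
  have hAP := h.mul_support_of_mul_self
  have hcorner : ∀ X : Elt M, Q * R * X * (Q * R) ∈ halfCorner A := fun X =>
    (mem_halfCorner_iff hQ hQA).2 ⟨R * X * R, by rw [h.comm]; simp only [mul_assoc, ← h.comm]⟩
  have hPT := support_mul_of_mem_aBounded h hQ hT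
  have hAD : ∀ D, Q * R * D = Q * R * D * (Q * R) → A * D * (Q * R) = A * D := by
    intro D hD
    calc A * D * (Q * R) = A * (Q * R) * D * (Q * R) := by rw [hAP]
      _ = A * (Q * R * D * (Q * R)) := by simp only [mul_assoc]
      _ = A * D := by rw [← hD, ← mul_assoc, hAP]
  ext z
  have hval : ∀ (τ : Elt M →L[ℂ] ℂ) (X Y : Elt M),
      τ (X * (algebraMap ℂ (Elt M) z - T) * Y) = z * τ (X * Y) - τ (X * T * Y) := by
    intro τ X Y
    simp [Algebra.algebraMap_eq_smul_one, mul_sub, sub_mul]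
  have hPD : Q * R * (algebraMap ℂ (Elt M) z - T) =
      Q * R * (algebraMap ℂ (Elt M) z - T) * (Q * R) := by
    rw [mul_sub, sub_mul, ← hPT, Algebra.algebraMap_eq_smul_one, mul_smul_comm, mul_one,
      smul_mul_assoc, h.support_mul_support]
  constructor
  · intro hz
    have hu : ¬ IsUnit (Q * R * (algebraMap ℂ (Elt M) z - T) * (Q * R) + (1 - Q * R)) := by
      intro hu
      obtain ⟨V, hVP, hPV, h1, h2⟩ := h.exists_corner_inverse hPD hu
      refine hz ⟨V, (mem_aBounded_iff hQ hQA).2 ⟨R * star V * Q, ?_⟩, h1, h2⟩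
      have : Q * R * star V = star V := by
        rw [← h.star_support, ← star_mul, hVP]
      rw [← mul_assoc, ← mul_assoc, this]
    obtain ⟨τ, ⟨hpos, hτA, hτp⟩, hτ⟩ := h.exists_pure_of_not_isUnit hPD hu
    rcases hτ with hτ | hτ
    · have key : ∀ S, S * (Q * R) = S → τ (A * S * T) = z * τ (A * S) := by
        intro S hS
        have := hval τ (A * S) 1
        rw [mul_one, mul_one, mul_one, hτ S hS] at this
        exact (sub_eq_zero.1 this.symm).symm
      have hz' : τ (A * T) = z := by
        have := key (Q * R) h.support_mul_support
        rwa [hAP, hτA, mul_one] at this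
      refine ⟨τ, .inl ⟨⟨hpos, hτA, hτp⟩, fun S hS => ?_⟩, hz'⟩
      obtain ⟨X, rfl⟩ := (mem_halfCorner_iff hQ hQA).1 hS
      rw [hz']
      exact key _ (by rw [mul_assoc, h.mul_support])
    · have key : ∀ S, Q * R * S = S → τ (A * T * S) = z * τ (A * S) := by
        intro S hS
        have := hval τ A S
        rw [hτ S hS] at this
        exact (sub_eq_zero.1 this.symm).symm
      have hz' : τ (A * T) = z := by
        have := key (Q * R) h.support_mul_support
        rwa [hAP, hτA, mul_one, hAD T hPT] at this
      refine ⟨τ, .inr ⟨⟨hpos, hτA, hτp⟩, fun S hS => ?_⟩, hz'⟩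
      obtain ⟨X, rfl⟩ := (mem_halfCorner_iff hQ hQA).1 hS
      rw [hz']
      exact key _ (by rw [← mul_assoc, ← mul_assoc, h.mul_mul_self])
  · rintro ⟨τ, hτ, rfl⟩ ⟨V, hV, h1, h2⟩
    have hPV := support_mul_of_mem_aBounded h hQ hV
    have hAV : A * (Q * R * V * (Q * R)) = A * V := by rw [← hPV, ← mul_assoc, hAP]
    rcases hτ with ⟨⟨-, hτA, -⟩, hτ⟩ | ⟨⟨-, hτA, -⟩, hτ⟩
    · have e := hval τ (A * V) 1
      have := hτ _ (hcorner V)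
      rw [hAV] at this
      rw [mul_one, mul_one, mul_one, h2, hτA, this, sub_self] at e
      exact one_ne_zero e
    · have e := hval τ A (Q * R * V * (Q * R))
      have := hτ _ (hcorner V)
      rw [this, sub_self, ← hPV, ← mul_assoc, hAD _ hPD, h1, hτA] at e
      exact one_ne_zero e

/-- For `A = 1` the `A`-spectrum is the spectrum. The zero algebra is treated apart: there the
spectrum is empty, and no functional takes the value `1` at `1 = 0`. -/
theorem spectrum_eq (T : Elt M) :
    spectrum ℂ T = {z : ℂ | ∃ g ∈ pureMult (1 : Elt M) T, g T = z} := by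
  rcases subsingleton_or_nontrivial (Elt M) with hs | hn
  · ext z
    refine iff_of_false ?_ ?_
    · rw [spectrum.of_subsingleton]; exact Set.notMem_empty z
    · rintro ⟨g, hg, -⟩
      have : g 1 = 1 := by rcases hg with hg | hg <;> exact hg.1.2.1
      rw [Subsingleton.elim (1 : Elt M) 0, map_zero] at this
      exact zero_ne_one this
  · have hpos : IsPos (1 : Elt M) := zero_le_one (α := H →L[ℂ] H)
    have hbd : ∀ T : Elt M, T ∈ aBounded 1 := fun T =>
      (mem_aBounded_iff zero_le_one (one_mul 1)).2 ⟨star T, by rw [one_mul, mul_one]⟩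
    have hws : WellSupported (1 : Elt M) := by
      rw [WellSupported, spectrum.one_eq]
      exact (Set.finite_singleton (1 : ℂ)).sdiff.isClosed
    have := aSpectrum_eq one_ne_zero hpos hws (hbd T)
    simp only [one_mul] at this
    rw [← this]
    ext z
    rw [spectrum.mem_iff, aSpectrum, Set.mem_ofPred_eq, not_iff_not, isUnit_iff_exists]
    constructor
    · rintro ⟨S, h1, h2⟩
      exact ⟨S, hbd S, by rw [one_mul, h1], by rw [one_mul, h2]⟩
    · rintro ⟨S, -, h1, h2⟩
      exact ⟨S, by rwa [one_mul] at h1, by rwa [one_mul] at h2⟩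

end VonNeumann

end ASpectrum

theorem theorem2p4 {H : Type*} [NormedAddCommGroup H] [InnerProductSpace ℂ H] [CompleteSpace H]
    (M : VonNeumannAlgebra H) :
    (∀ A : ASpectrum.Elt M, A ≠ 0 → ASpectrum.IsPos A → ASpectrum.WellSupported A →
      ∀ T ∈ ASpectrum.aBounded A,
        ASpectrum.aSpectrum A T = {z : ℂ | ∃ g ∈ ASpectrum.pureMult A T, g (A * T) = z}) ∧
    (∀ T : ASpectrum.Elt M,
      spectrum ℂ T = {z : ℂ | ∃ g ∈ ASpectrum.pureMult (1 : ASpectrum.Elt M) T, g T = z}) := by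
  exact ⟨fun _ hA0 hA hws _ hT => ASpectrum.aSpectrum_eq hA0 hA hws hT, ASpectrum.spectrum_eq⟩
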